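/- View the line as two rays meeting at the origin $O$. A search strategy is a sequence $X=(x_i,u_i)_{i\ge 0}$ with lengths $x_i>0$ and rays $u_i\in\{0,1\}$: in iteration $i$ the searcher starts at $O$, walks along ray $u_i$ up to distance $x_i$, and returns to $O$. For a target $t$ at distance $d(t)$ from $O$ on one of the rays, let $d(X,t)$ be the distance walked until $t$ is reached for the first time: it equals $2\sum_{j<i}x_j+d(t)$ for the first $i$ such that $t$ lies on ray $u_i$ and $d(t)\le x_i$, and it is $\infty$ if there is no such $i$. Fix $\delta>0$; all targets are assumed to satisfy $d(t)\ge\delta$. A strategy with $k$-bit advice consists of a map $t\mapsto h(t)\in\{0,1\}^k$ (the error-free advice) and of a search strategy $X_h$ for every $h\in\{0,1\}^k$. Its consistency is $\sup_t d(X_{h(t)},t)/d(t)$, and its robustness is $\sup_{h\in\{0,1\}^k}\sup_t d(X_h,t)/d(t)$; it is $r$-robust if its robustness is at most $r$. For $r\ge 9$, let $b_r$ be the largest $b>1$ with $1+2\frac{b^2}{b-1}\le r$ (here $1+2\frac{b^2}{b-1}$ is the competitive ratio $\sup_t d(X,t)/d(t)$ of the geometric strategy $x_i=b^i$, $u_i=i\bmod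 2$, for $\delta=1$; equivalently, $b_r$ is the largest real root of $\frac{x^2}{x-1}=\frac{r-1}{2}$). **Theorem.** For every $r\ge 9$ and every integer $k\ge 1$, every $r$-robust strategy for searching on the line with untrusted $k$-bit advice has consistency at least $$1+2\,\frac{b_r^{1/q}}{b_r-1},\qquad q=2^{k-1}.$$ -/

import Mathlib

open scoped ENNReal

noncomputable section

namespace LinearSearch

/-- A search strategy on the line, viewed as two rays (labelled `0` and `1`) meeting at the
origin: in iteration `i` the searcher leaves the origin, walks along `ray i` up to distance
`length i`, and walks back to the origin. -/
structure Strategy where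
  length : ℕ → ℝ
  ray : ℕ → Fin 2
  length_pos : ∀ i, 0 < length i

/-- A target on the line: a ray and a distance from the origin. All targets are at distance at
least the fixed value `δ`. -/
structure Target (δ : ℝ) where
  ray : Fin 2
  dist : ℝ
  le_dist : δ ≤ dist

variable {δ : ℝ}

/-- The `i`-th segment of `X` reaches the target `t`. -/
def Strategy.Reaches (X : Strategy) (t : Target δ) (i : ℕ) : Prop :=
  X.ray i = t.ray ∧ t.dist ≤ X.length i

open Classical in
/-- `d(X, t)`: the distance covered by the searcher until the target is reached for the first time
(`∞` if it is never reached). -/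
def Strategy.cost (X : Strategy) (t : Target δ) : ℝ≥0∞ :=
  if h : ∃ i, X.Reaches t i then
    ENNReal.ofReal (2 * ∑ j ∈ Finset.range (Nat.find h), X.length j + t.dist)
  else ∞

/-- The competitive ratio `sup_t d(X, t) / d(t)`, over all targets at distance at least `δ`. -/
def Strategy.competitiveRatio (δ : ℝ) (X : Strategy) : ℝ≥0∞ :=
  ⨆ t : Target δ, X.cost t / ENNReal.ofReal t.dist

/-- A strategy with `k` bits of advice: the advice string that a target gives rise to when there
is no error, and the search strategy that is followed upon receiving each given string. -/
structure AdviceStrategy (δ : ℝ) (k : ℕ) where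
  advice : Target δ → (Fin k → Bool)
  strategy : (Fin k → Bool) → Strategy

variable {k : ℕ}

/-- Consistency: the competitive ratio when the advice is error-free. -/
def AdviceStrategy.consistency (A : AdviceStrategy δ k) : ℝ≥0∞ :=
  ⨆ t : Target δ, (A.strategy (A.advice t)).cost t / ENNReal.ofReal t.dist

/-- Robustness: the competitive ratio when the advice is chosen adversarially. -/
def AdviceStrategy.robustness (A : AdviceStrategy δ k) : ℝ≥0∞ :=
  ⨆ h : Fin k → Bool, (A.strategy h).competitiveRatio δ

/-- `A` is `r`-robust if its robustness is at most `r`. -/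
def AdviceStrategy.IsRobust (A : AdviceStrategy δ k) (r : ℝ) : Prop :=
  A.robustness ≤ ENNReal.ofReal r

/-- `b_r`: the largest `b > 1` for which the competitive ratio `1 + 2 b ^ 2 / (b - 1)` of the
geometric strategy with base `b` (for targets at distance at least `1`) is at most `r`. -/
def geomBase (r : ℝ) : ℝ :=
  sSup {b : ℝ | 1 < b ∧ 1 + 2 * (b ^ 2 / (b - 1)) ≤ r}

/-- For `9 ≤ r` the supremum that defines `b_r` is a maximum. -/
theorem isGreatest_geomBase {r : ℝ} (hr : 9 ≤ r) :
    IsGreatest {b : ℝ | 1 < b ∧ 1 + 2 * (b ^ 2 / (b - 1)) ≤ r} (geomBase r) := by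
  obtain ⟨p, hp⟩ : ∃ p : ℝ, p = (r - 1) / 2 := ⟨_, rfl⟩
  obtain ⟨s, hs⟩ : ∃ s : ℝ, s = Real.sqrt (p ^ 2 - 4 * p) := ⟨_, rfl⟩
  have hp4 : 4 ≤ p := by linarith
  have hs0 : 0 ≤ s := hs ▸ Real.sqrt_nonneg _
  have hsq : s ^ 2 = p ^ 2 - 4 * p := by rw [hs]; exact Real.sq_sqrt (by nlinarith)
  have key : IsGreatest {b : ℝ | 1 < b ∧ 1 + 2 * (b ^ 2 / (b - 1)) ≤ r} ((p + s) / 2) := by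
    constructor
    · refine ⟨by linarith, ?_⟩
      have : ((p + s) / 2) ^ 2 / ((p + s) / 2 - 1) ≤ p := by
        rw [div_le_iff₀ (by linarith)]
        nlinarith
      linarith
    · rintro b ⟨hb1, hb⟩
      have h1 : b ^ 2 / (b - 1) ≤ p := by linarith
      rw [div_le_iff₀ (by linarith)] at h1
      have h2 : (2 * b - p) ^ 2 ≤ s ^ 2 := by nlinarith
      have h3 := (abs_le.1 (abs_le_of_sq_le_sq h2 hs0)).2
      linarith
  unfold geomBase
  rw [key.csSup_eq]
  exact key

end LinearSearch

end

open scoped ENNReal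

namespace LinearSearch

open MeasureTheory Set

variable {δ : ℝ}

/-! Distances are measured on a logarithmic scale. With `p = (r - 1) / 2`, cut a robust strategy
into blocks exploring one ray each, and let `σ n` be half the distance walked before block `n`.
Robustness forces `σ (n + 2) ≤ p * (σ (n + 1) - σ n)` (`Strategy.exists_blocks`), so the ratios `σ
(n + 1) / σ n` eventually stay below any `c > b_r` (`exists_forall_ratio_le`).

Block `n` serves a target at distance `d` within `ρ` only if `σ n / ρ ≤ d ≤ σ (n + 1) - σ n`. For
ratio `a`, this interval has logarithmic length at most `log (ρ * (a - 1))`, which is at most `e *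
log a` when `ρ * (c - 1) ≤ c ^ e`. The sum telescopes: up to log-distance `L`, one strategy serves
measure at most `e * L + O(1)` over both rays together (`sum_volume_log_le`).

The `2 ^ k` strategies must cover measure `2 * L - O(1)`, so `2 ^ k * e ≥ 2`. A consistency below
the bound would permit some `c > b_r` and `e < 1 / q`, a contradiction. -/

/-! ### Targets that are served at a bounded relative cost -/

/-- Half of the distance walked before iteration `i`. -/
def Strategy.partialLength (X : Strategy) (i : ℕ) : ℝ :=
  ∑ j ∈ Finset.range i, X.length j

/-- The iteration `i` is the first to reach `t`. -/
def Strategy.FirstReaches (X : Strategy) (t : Target δ) (i : ℕ) : Prop :=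
  X.Reaches t i ∧ ∀ j < i, ¬ X.Reaches t j

/-- The target `t` is reached in an iteration before which the searcher has walked at most
`2 * ρ * d(t)`. -/
def Strategy.ServedWithin (X : Strategy) (ρ : ℝ) (t : Target δ) : Prop :=
  ∃ i, X.FirstReaches t i ∧ X.partialLength i ≤ ρ * t.dist

theorem Strategy.partialLength_succ (X : Strategy) (i : ℕ) :
    X.partialLength (i + 1) = X.partialLength i + X.length i :=
  Finset.sum_range_succ _ _

theorem Strategy.partialLength_mono (X : Strategy) : Monotone X.partialLength :=
  monotone_nat_of_le_succ fun i => by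
    rw [X.partialLength_succ]
    linarith [X.length_pos i]

theorem Strategy.partialLength_nonneg (X : Strategy) (i : ℕ) : 0 ≤ X.partialLength i :=
  Finset.sum_nonneg fun j _ => (X.length_pos j).le

theorem Strategy.length_le_sub (X : Strategy) {i j m : ℕ} (hij : i ≤ j) (hjm : j < m) :
    X.length j ≤ X.partialLength m - X.partialLength i := by
  have h1 := X.partialLength_mono hij
  have h2 := X.partialLength_mono (Nat.succ_le_of_lt hjm)
  rw [Nat.succ_eq_add_one, X.partialLength_succ] at h2
  linarith

theorem Strategy.servedWithin_of_cost_le (X : Strategy) (hδ : 0 < δ) {ρ : ℝ} (t : Target δ)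
    (h : X.cost t / ENNReal.ofReal t.dist ≤ ENNReal.ofReal (1 + 2 * ρ)) :
    X.ServedWithin ρ t := by
  classical
  have hd : 0 < t.dist := hδ.trans_le t.le_dist
  rw [ENNReal.div_le_iff (by simpa using hd) ENNReal.ofReal_ne_top,
    ← ENNReal.ofReal_mul' hd.le] at h
  unfold Strategy.cost at h
  split_ifs at h with hex
  · refine ⟨Nat.find hex, ⟨Nat.find_spec hex, fun j hj => Nat.find_min hex hj⟩, ?_⟩
    have h0 := X.partialLength_nonneg (Nat.find hex)
    unfold Strategy.partialLength at h0 ⊢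
    -- The second alternative, a nonpositive cost, is impossible since `t.dist` is positive.
    rw [ENNReal.ofReal_le_ofReal_iff'] at h
    rcases h with h | h <;> nlinarith
  · simp at h

theorem Strategy.FirstReaches.le_length {X : Strategy} {t : Target δ} {i : ℕ}
    (h : X.FirstReaches t i) : t.dist ≤ X.length i := h.1.2

/-! ### Records and blocks -/

/-- Iteration `i` explores new territory, beyond distance `δ`. -/
def Strategy.IsRecord (δ : ℝ) (X : Strategy) (i : ℕ) : Prop :=
  δ < X.length i ∧ ∀ j < i, X.ray j = X.ray i → X.length j < X.length i

theorem Strategy.FirstReaches.isRecord {X : Strategy} {t : Target δ} {i : ℕ}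
    (h : X.FirstReaches t i) (ht : δ < t.dist) : X.IsRecord δ i := by
  refine ⟨ht.trans_le h.le_length, fun j hj hray => lt_of_lt_of_le ?_ h.le_length⟩
  by_contra! hle
  exact h.2 j hj ⟨hray.trans h.1.1, hle⟩

/-- A target farther away than the sum of the first `m + 1` lengths is reached only after iteration
`m`, and its first visit is a record. -/
theorem Strategy.exists_isRecord_gt (X : Strategy) {p : ℝ}
    (hX : ∀ t : Target δ, X.ServedWithin p t) (v : Fin 2) (m : ℕ) :
    ∃ i, m < i ∧ X.IsRecord δ i ∧ X.ray i = v := by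
  have hS : 0 ≤ X.partialLength (m + 1) := X.partialLength_nonneg _
  obtain ⟨i, hi, -⟩ := hX ⟨v, |δ| + X.partialLength (m + 1) + 1, by linarith [le_abs_self δ]⟩
  refine ⟨i, ?_, hi.isRecord (by simp only; linarith [le_abs_self δ]), hi.1.1⟩
  by_contra! hle
  have h1 := hi.le_length
  have h2 := X.length_le_sub (Nat.zero_le i) (Nat.lt_succ_of_le hle)
  simp only [Nat.succ_eq_add_one] at h1 h2
  linarith [X.partialLength_nonneg 0, abs_nonneg δ]

/-- A strategy that serves all targets splits into blocks of iterations that explore new territory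
on one ray only; `σ n` is the total length of the iterations before the `n`-th block, and `u n` the
ray that it explores. -/
theorem Strategy.exists_blocks (X : Strategy) {p : ℝ} (hp : 0 < p)
    (hX : ∀ t : Target δ, X.ServedWithin p t) :
    ∃ (σ : ℕ → ℝ) (u : ℕ → Fin 2), 0 ≤ σ 0 ∧ (∀ n, σ n + δ ≤ σ (n + 1)) ∧
      (∀ n, σ (n + 2) ≤ p * (σ (n + 1) - σ n)) ∧
      ∀ (t : Target δ) (i : ℕ), δ < t.dist → X.FirstReaches t i →
        ∃ n, u n = t.ray ∧ t.dist ≤ σ (n + 1) - σ n ∧ σ n ≤ X.partialLength i := by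
  classical
  have hfirst : ∃ i, X.IsRecord δ i := by
    obtain ⟨i, -, hi, -⟩ := X.exists_isRecord_gt hX 0 0
    exact ⟨i, hi⟩
  have hnext : ∀ i, ∃ j, i < j ∧ X.IsRecord δ j ∧ X.ray j ≠ X.ray i := by
    intro i
    obtain ⟨v, hv⟩ := exists_ne (X.ray i)
    obtain ⟨j, hj, hr, rfl⟩ := X.exists_isRecord_gt hX v i
    exact ⟨j, hj, hr, hv⟩
  let next : ℕ → ℕ := fun i => Nat.find (hnext i)
  let start : ℕ → ℕ := fun n => next^[n] (Nat.find hfirst)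
  have hsucc : ∀ n, start (n + 1) = next (start n) := fun n =>
    Function.iterate_succ_apply' _ _ _
  have hspec : ∀ n, start n < start (n + 1) ∧ X.IsRecord δ (start (n + 1)) ∧
      X.ray (start (n + 1)) ≠ X.ray (start n) := fun n => by
    rw [hsucc]
    exact Nat.find_spec (hnext (start n))
  have hmin : ∀ n j, start n < j → X.IsRecord δ j → X.ray j ≠ X.ray (start n) →
      start (n + 1) ≤ j := fun n j h1 h2 h3 => by
    rw [hsucc]
    exact Nat.find_min' (hnext (start n)) ⟨h1, h2, h3⟩
  have hrec : ∀ n, X.IsRecord δ (start n) := by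
    rintro (_ | n)
    · exact Nat.find_spec hfirst
    · exact (hspec n).2.1
  have hmono : StrictMono start := strictMono_nat_of_lt_succ fun n => (hspec n).1
  have hlen : ∀ n j, start n ≤ j → j < start (n + 1) →
      X.length j ≤ X.partialLength (start (n + 1)) - X.partialLength (start n) :=
    fun n j h1 h2 => X.length_le_sub h1 h2
  refine ⟨fun n => X.partialLength (start n), fun n => X.ray (start n),
    X.partialLength_nonneg _, fun n => ?_, fun n => ?_, fun t i ht hi => ?_⟩
  · have := hlen n _ le_rfl (hspec n).1
    linarith [(hrec n).1]
  · set w := X.partialLength (start (n + 1)) - X.partialLength (start n)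
    have hnw : X.length (start n) ≤ w := hlen n _ le_rfl (hspec n).1
    -- A target on the ray of block `n` just beyond `w` is out of reach up to the end of that block,
    -- and block `n + 1` starts on the other ray. Its first visit is a record, hence comes no
    -- earlier than block `n + 2`. Letting `d` decrease to `w` gives the recurrence.
    have hkey : ∀ d, w < d → X.partialLength (start (n + 2)) ≤ p * d := by
      intro d hd
      have hδd : δ < d := by linarith [(hrec n).1]
      obtain ⟨i, hi, hcost⟩ := hX ⟨X.ray (start n), d, hδd.le⟩
      refine le_trans (X.partialLength_mono ?_) hcost
      have hray : X.ray i = X.ray (start n) := hi.1.1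
      have hdi : d ≤ X.length i := hi.le_length
      have hi1 : start (n + 1) ≤ i := by
        by_contra! hlt
        rcases le_or_gt (start n) i with hle | hlt'
        · linarith [hlen n i hle hlt]
        · linarith [(hrec n).2 i hlt' hray]
      refine hmin (n + 1) i (lt_of_le_of_ne hi1 ?_) (hi.isRecord hδd) ?_
      · rintro rfl
        exact (hspec n).2.2 hray
      · rw [hray]
        exact (hspec n).2.2.symm
    refine le_of_forall_pos_le_add fun ε hε => ?_
    have := hkey (w + ε / p) (by linarith [div_pos hε hp])
    rwa [mul_add, mul_div_cancel₀ _ hp.ne'] at this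
  · have hir := hi.isRecord ht
    have h0 : start 0 ≤ i := Nat.find_min' hfirst hir
    obtain ⟨n, hn1, hn2⟩ : ∃ n, start n ≤ i ∧ i < start (n + 1) := by
      have hex : ∃ m, i < start m := ⟨i + 1, (Nat.lt_succ_self i).trans_le (hmono.id_le _)⟩
      have hf := Nat.find_spec hex
      obtain ⟨m, hm⟩ : ∃ m, Nat.find hex = m + 1 :=
        Nat.exists_eq_succ_of_ne_zero fun h => by
          rw [h] at hf
          omega
      refine ⟨m, not_lt.1 (Nat.find_min hex (by omega)), ?_⟩
      rwa [hm] at hf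
    refine ⟨n, ?_, hi.le_length.trans (hlen n i hn1 hn2), X.partialLength_mono hn1⟩
    have hray : X.ray i = t.ray := hi.1.1
    rw [← hray]
    change X.ray (start n) = X.ray i
    by_contra hne
    have hlt : start n < i := lt_of_le_of_ne hn1 fun h => hne (by rw [h])
    exact absurd (hmin n i hlt hir (Ne.symm hne)) (not_le.2 hn2)

/-! ### Growth of robust strategies -/

theorem mul_sub_one_lt_sq_of_geomBase_lt {r : ℝ} (hr : 9 ≤ r) {c : ℝ} (hc : geomBase r < c) :
    (r - 1) / 2 * (c - 1) < c ^ 2 := by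
  have hg := isGreatest_geomBase hr
  have hc1 : 1 < c := hg.1.1.trans hc
  by_contra! hle
  refine absurd (hg.2 ⟨hc1, ?_⟩) (not_le.2 hc)
  have : c ^ 2 / (c - 1) ≤ (r - 1) / 2 := by
    rwa [div_le_iff₀ (by linarith)]
  linarith

/-- The vertex `p / 2` of `x ^ 2 - p * x + p`, where `p = (r - 1) / 2`, is admissible because `p ≥
4`. This supplies the condition `p / 2 ≤ c` for `c > b_r`. -/
theorem le_geomBase {r : ℝ} (hr : 9 ≤ r) : (r - 1) / 4 ≤ geomBase r := by
  refine (isGreatest_geomBase hr).2 ⟨by linarith, ?_⟩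
  have : ((r - 1) / 4) ^ 2 / ((r - 1) / 4 - 1) ≤ (r - 1) / 2 := by
    rw [div_le_iff₀ (by linarith)]
    nlinarith
  linarith

/-- The ratios of a positive sequence with `σ (n + 2) ≤ p * (σ (n + 1) - σ n)` are eventually at
most `c`, for every `c ≥ p / 2` with `p * (c - 1) < c ^ 2`. -/
theorem exists_forall_ratio_le {σ : ℕ → ℝ} {p c : ℝ} (hp : 0 < p) (hσ : ∀ n, 0 < σ n)
    (hrec : ∀ n, σ (n + 2) ≤ p * (σ (n + 1) - σ n)) (hpc : p / 2 ≤ c)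
    (hc : p * (c - 1) < c ^ 2) : ∃ m, ∀ n, m ≤ n → σ (n + 1) ≤ c * σ n := by
  set a : ℕ → ℝ := fun n => σ (n + 1) / σ n with ha
  have hapos : ∀ n, 0 < a n := fun n => div_pos (hσ _) (hσ _)
  have hstep : ∀ n, a (n + 1) * a n ≤ p * (a n - 1) := by
    intro n
    have h1 := (hσ n).ne'
    have h2 := (hσ (n + 1)).ne'
    have e1 : a (n + 1) * a n = σ (n + 2) / σ n := by
      simp only [ha]
      field_simp
    have e2 : p * (a n - 1) = p * (σ (n + 1) - σ n) / σ n := by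
      simp only [ha]
      field_simp
    rw [e1, e2]
    exact div_le_div_of_nonneg_right (hrec n) (hσ n).le
  have hap : ∀ n, a (n + 1) ≤ p := fun n => by nlinarith [hstep n, hapos n]
  have hc0 : 0 < c := by linarith
  have hkeep : ∀ n, a n ≤ c → a (n + 1) ≤ c := by
    intro n hn
    have h1 := hstep n
    have h2 := hapos n
    have h3 : a (n + 1) * a n ≤ c * a n := by
      by_contra! h
      nlinarith
    exact le_of_mul_le_mul_right h3 h2
  obtain ⟨η, hη⟩ : ∃ η, η = (c ^ 2 - p * (c - 1)) / p := ⟨_, rfl⟩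
  have hη0 : 0 < η := hη ▸ div_pos (by linarith) hp
  have hηp : η * p = c ^ 2 - p * (c - 1) := by
    rw [hη]
    field_simp
  -- `x ^ 2 - p * (x - 1)` increases on `[p / 2, ∞)`, so beyond `c` it is at least `η * p`, hence at
  -- least `η * a (n + 1)`. The shifted index makes `hap` available.
  have hdec : ∀ n, c < a (n + 1) → a (n + 2) ≤ a (n + 1) - η := by
    intro n hn
    have h1 := hstep (n + 1)
    have h2 := hapos (n + 1)
    have h3 := mul_le_mul_of_nonneg_left (hap n) hη0.le
    have h4 : c ^ 2 - p * (c - 1) ≤ a (n + 1) ^ 2 - p * (a (n + 1) - 1) := by nlinarith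
    refine le_of_mul_le_mul_right ?_ h2
    nlinarith
  obtain ⟨m, hm⟩ : ∃ m, a m ≤ c := by
    by_contra! hgt
    have hlin : ∀ n : ℕ, a (n + 1) ≤ p - n * η := by
      intro n
      induction n with
      | zero => simpa using hap 0
      | succ n ih =>
        have := hdec n (hgt _)
        push_cast
        linarith
    obtain ⟨n, hn⟩ := exists_nat_gt (p / η)
    rw [div_lt_iff₀ hη0] at hn
    linarith [hlin n, hapos (n + 1)]
  refine ⟨m, fun n hn => ?_⟩
  have : a n ≤ c := by
    induction n, hn using Nat.le_induction with
    | base => exact hm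
    | succ n _ ih => exact hkeep n ih
  rwa [ha, div_le_iff₀ (hσ n)] at this

/-! ### Logarithmic measure of the targets that are served well -/

/-- The inequality passes from `c` to smaller ratios: `(a - 1) / a ≤ (c - 1) / c`, and `a / c ≤ (a /
c) ^ e` because `a / c ≤ 1` and `e ≤ 1`. -/
theorem mul_sub_one_le_rpow {ρ c e a : ℝ} (hρ : 0 ≤ ρ) (hc : ρ * (c - 1) ≤ c ^ e) (he : e ≤ 1)
    (ha : 1 ≤ a) (hac : a ≤ c) : ρ * (a - 1) ≤ a ^ e := by
  rcases ha.eq_or_lt with rfl | ha1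
  · simp
  have hc0 : 0 < c := by linarith
  have h1 : a / c ≤ (a / c) ^ e := by
    have := Real.rpow_le_rpow_of_exponent_ge (x := a / c) (by positivity)
      ((div_le_one hc0).2 hac) he
    simpa using this
  have h2 : (a - 1) ≤ a / c * (c - 1) := by
    rw [div_mul_eq_mul_div, le_div_iff₀ hc0]
    nlinarith
  have h3 : (a / c) ^ e * c ^ e = a ^ e := by
    rw [← Real.mul_rpow (by positivity) hc0.le, div_mul_cancel₀ _ hc0.ne']
  calc ρ * (a - 1) ≤ ρ * (a / c * (c - 1)) := mul_le_mul_of_nonneg_left h2 hρ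
    _ = a / c * (ρ * (c - 1)) := by ring
    _ ≤ a / c * c ^ e := mul_le_mul_of_nonneg_left hc (by positivity)
    _ ≤ (a / c) ^ e * c ^ e := mul_le_mul_of_nonneg_right h1 (by positivity)
    _ = a ^ e := h3

/-- If the ratios of `σ` are at most `c`, the logarithms of the points of the intervals
`[σ n / ρ, σ (n + 1) - σ n]` have density at most `e`. -/
theorem sum_volume_log_le {σ : ℕ → ℝ} {ρ c e : ℝ} (u : ℕ → Fin 2) (m : ℕ) (hρ : 0 < ρ)
    (he0 : 0 ≤ e) (he1 : e ≤ 1) (hce : ρ * (c - 1) ≤ c ^ e)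
    (hσ : ∀ n, 0 < σ n) (hmono : StrictMono σ) (hσc : ∀ n, m ≤ n → σ (n + 1) ≤ c * σ n)
    (htop : Filter.Tendsto σ Filter.atTop Filter.atTop) (L : ℝ) :
    ∑ v, volume {s : ℝ | s ≤ L ∧ ∃ n, m ≤ n ∧ u n = v ∧ σ n ≤ ρ * Real.exp s ∧
        Real.exp s ≤ σ (n + 1) - σ n} ≤
      ENNReal.ofReal (e * L + e * (Real.log (c * ρ) - Real.log (σ m))) := by
  classical
  have hc0 : 0 < c := pos_of_mul_pos_left ((hσ _).trans_le (hσc m le_rfl)) (hσ m).le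
  have hbound : ∀ {n s}, s ≤ L → σ n ≤ ρ * Real.exp s → σ n ≤ ρ * Real.exp L :=
    fun hs h => h.trans (mul_le_mul_of_nonneg_left (Real.exp_le_exp.2 hs) hρ.le)
  -- `N` is the first index with `σ N > ρ * exp L`: later blocks contribute nothing, and the ratio
  -- bound keeps the overshoot below a factor `c`.
  obtain ⟨N, hN, hNL⟩ : ∃ N, (∀ n, σ n ≤ ρ * Real.exp L → n < N) ∧
      (m < N → σ N ≤ c * (ρ * Real.exp L)) := by
    have hex : ∃ N, ρ * Real.exp L < σ N := (htop.eventually_gt_atTop _).exists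
    refine ⟨Nat.find hex, fun n hn => ?_, fun hm => ?_⟩
    · by_contra! hle
      exact absurd (Nat.find_spec hex) (not_lt.2 ((hmono.monotone hle).trans hn))
    · obtain ⟨M, hM⟩ : ∃ M, Nat.find hex = M + 1 := Nat.exists_eq_succ_of_ne_zero (by omega)
      have h1 : σ M ≤ ρ * Real.exp L := not_lt.1 (Nat.find_min hex (by omega))
      rw [hM]
      exact (hσc M (by omega)).trans (mul_le_mul_of_nonneg_left h1 hc0.le)
  have hterm : ∀ n, m ≤ n → Real.log (σ (n + 1) - σ n) - (Real.log (σ n) - Real.log ρ) ≤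
      e * (Real.log (σ (n + 1)) - Real.log (σ n)) := by
    intro n hn
    have hn0 := hσ n
    have hn1 := hσ (n + 1)
    have hlt : 0 < σ (n + 1) - σ n := sub_pos.2 (hmono n.lt_succ_self)
    have key := mul_sub_one_le_rpow (a := σ (n + 1) / σ n) hρ.le hce he1
      ((one_le_div hn0).2 (by linarith)) ((div_le_iff₀ hn0).2 (hσc n hn))
    have heq : ρ * (σ (n + 1) / σ n - 1) = ρ * (σ (n + 1) - σ n) / σ n := by field_simp
    rw [heq] at key
    have := Real.log_le_log (by positivity) key
    rw [Real.log_div (by positivity) hn0.ne', Real.log_mul hρ.ne' hlt.ne',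
      Real.log_rpow (by positivity), Real.log_div hn1.ne' hn0.ne'] at this
    linarith
  have hnonneg : ∀ n, 0 ≤ e * (Real.log (σ (n + 1)) - Real.log (σ n)) := fun n =>
    mul_nonneg he0 (sub_nonneg.2 (Real.log_le_log (hσ n) (hmono n.lt_succ_self).le))
  have hvol : ∀ v, volume {s : ℝ | s ≤ L ∧ ∃ n, m ≤ n ∧ u n = v ∧ σ n ≤ ρ * Real.exp s ∧
        Real.exp s ≤ σ (n + 1) - σ n} ≤
      ∑ n ∈ Finset.Ico m N with u n = v,
        ENNReal.ofReal (e * (Real.log (σ (n + 1)) - Real.log (σ n))) := by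
    intro v
    have hsub : {s : ℝ | s ≤ L ∧ ∃ n, m ≤ n ∧ u n = v ∧ σ n ≤ ρ * Real.exp s ∧
        Real.exp s ≤ σ (n + 1) - σ n} ⊆
        ⋃ n ∈ {n ∈ Finset.Ico m N | u n = v},
          Icc (Real.log (σ n) - Real.log ρ) (Real.log (σ (n + 1) - σ n)) := by
      rintro s ⟨hs, n, hmn, hun, h1, h2⟩
      simp only [mem_iUnion, Finset.mem_filter, Finset.mem_Ico]
      refine ⟨n, ⟨⟨hmn, hN n (hbound hs h1)⟩, hun⟩, ?_, ?_⟩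
      · have := Real.log_le_log (hσ n) h1
        rw [Real.log_mul hρ.ne' (Real.exp_ne_zero _), Real.log_exp] at this
        linarith
      · have := Real.log_le_log (Real.exp_pos s) h2
        rwa [Real.log_exp] at this
    refine (measure_mono hsub).trans ((measure_biUnion_finset_le _ _).trans ?_)
    refine Finset.sum_le_sum fun n hn => ?_
    rw [Real.volume_Icc]
    exact ENNReal.ofReal_le_ofReal
      (hterm n (Finset.mem_Ico.1 (Finset.mem_filter.1 hn).1).1)
  refine (Finset.sum_le_sum fun v _ => hvol v).trans ?_
  -- Each block belongs to one ray only, so summing over the rays counts it once and the total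
  -- telescopes.
  rw [Finset.sum_fiberwise, ← ENNReal.ofReal_sum_of_nonneg fun n _ => hnonneg n]
  rcases le_or_gt N m with hNm | hmN
  · simp [Finset.Ico_eq_empty_of_le hNm]
  refine ENNReal.ofReal_le_ofReal ?_
  rw [← Finset.mul_sum, Finset.sum_Ico_sub (fun n => Real.log (σ n)) hmN.le, ← mul_add]
  refine mul_le_mul_of_nonneg_left ?_ he0
  have := Real.log_le_log (hσ N) (hNL hmN)
  rw [← mul_assoc, Real.log_mul (mul_pos hc0 hρ).ne' (Real.exp_ne_zero _), Real.log_exp] at this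
  linarith

/-- The logarithms of the distances of the targets on ray `v` that are served within `ρ`. -/
def Strategy.servedLogs (δ : ℝ) (X : Strategy) (ρ : ℝ) (v : Fin 2) : Set ℝ :=
  {s | ∃ t : Target δ, t.ray = v ∧ t.dist = Real.exp s ∧ X.ServedWithin ρ t}

theorem Strategy.exists_sum_volume_servedLogs_le (X : Strategy) (hδ : 0 < δ) {p c ρ e : ℝ}
    (hp : 0 < p) (hpc : p / 2 ≤ c) (hc : p * (c - 1) < c ^ 2)
    (hρ : 0 < ρ) (he0 : 0 ≤ e) (he1 : e ≤ 1) (hce : ρ * (c - 1) ≤ c ^ e)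
    (hX : ∀ t : Target δ, X.ServedWithin p t) :
    ∃ K C : ℝ, ∀ L, ∑ v, volume (X.servedLogs δ ρ v ∩ Ioc K L) ≤
      ENNReal.ofReal (e * L + C) := by
  obtain ⟨σ, u, h0, hgrow, hrec, hserve⟩ := X.exists_blocks hp hX
  have hmono : StrictMono σ := strictMono_nat_of_lt_succ fun n => by linarith [hgrow n]
  have hpos : ∀ n, 0 < σ (n + 1) := fun n => h0.trans_lt (hmono n.succ_pos)
  have htop : Filter.Tendsto σ Filter.atTop Filter.atTop := by
    have hlin : ∀ n : ℕ, n * δ ≤ σ n := by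
      intro n
      induction n with
      | zero => simpa using h0
      | succ n ih =>
        push_cast
        linarith [hgrow n]
    exact Filter.tendsto_atTop_mono hlin
      (tendsto_natCast_atTop_atTop.atTop_mul_const hδ)
  -- The sequence is shifted by one because `σ 0` may vanish.
  obtain ⟨m, hm⟩ := exists_forall_ratio_le (σ := fun n => σ (n + 1)) hp hpos
    (fun n => hrec (n + 1)) hpc hc
  -- A distance above `σ (m + 1)` cannot fit in a block of index at most `m`, so only blocks with
  -- settled ratios serve such targets.
  refine ⟨Real.log (max δ (σ (m + 1))),
    e * (Real.log (c * ρ) - Real.log (σ (m + 1))), fun L => le_trans ?_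
    (sum_volume_log_le (σ := fun n => σ (n + 1)) (fun n => u (n + 1)) m hρ he0 he1 hce hpos
      (fun i j hij => hmono (by omega)) hm
      (htop.comp (Filter.tendsto_add_atTop_nat 1)) L)⟩
  refine Finset.sum_le_sum fun v _ => measure_mono ?_
  rintro s ⟨⟨t, htv, hts, i, hi, hcost⟩, hKs, hsL⟩
  have hlt : max δ (σ (m + 1)) < Real.exp s :=
    (Real.log_lt_iff_lt_exp (lt_max_of_lt_left hδ)).1 hKs
  rw [max_lt_iff] at hlt
  obtain ⟨n, hn, hd, hle⟩ := hserve t i (hts ▸ hlt.1) hi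
  rw [hts] at hd hcost
  have hmn : m + 1 ≤ n := by
    by_contra! h
    have h1 : σ (n + 1) ≤ σ (m + 1) := hmono.monotone (by omega)
    have h2 : 0 ≤ σ n := h0.trans (hmono.monotone n.zero_le)
    linarith [hlt.2]
  obtain ⟨l, rfl⟩ : ∃ l, n = l + 1 := ⟨n - 1, by omega⟩
  exact ⟨hsL, l, by omega, hn.trans htv, hle.trans hcost, hd⟩

/-! ### Advice -/

variable {k : ℕ}

theorem AdviceStrategy.servedWithin_of_isRobust (A : AdviceStrategy δ k) (hδ : 0 < δ) {r : ℝ}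
    (hA : A.IsRobust r) (h : Fin k → Bool) (t : Target δ) :
    (A.strategy h).ServedWithin ((r - 1) / 2) t := by
  refine (A.strategy h).servedWithin_of_cost_le hδ t ?_
  rw [show 1 + 2 * ((r - 1) / 2) = r by ring]
  refine le_trans ?_ hA
  exact le_trans (le_iSup (fun t : Target δ => (A.strategy h).cost t / ENNReal.ofReal t.dist) t)
    (le_iSup (fun h => (A.strategy h).competitiveRatio δ) h)

theorem AdviceStrategy.servedWithin_of_consistency_le (A : AdviceStrategy δ k) (hδ : 0 < δ)
    {ρ : ℝ} (hA : A.consistency ≤ ENNReal.ofReal (1 + 2 * ρ)) (t : Target δ) :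
    (A.strategy (A.advice t)).ServedWithin ρ t :=
  (A.strategy _).servedWithin_of_cost_le hδ t <| le_trans
    (le_iSup (fun t : Target δ => (A.strategy (A.advice t)).cost t / ENNReal.ofReal t.dist) t) hA

/-- Consistency makes the sets `servedLogs` of the `2 ^ k` strategies cover both rays, whose
log-measure up to `L` grows like `2 * L`. They supply only `2 ^ k * e * L + O(1)`, too little for
large `L`. -/
theorem AdviceStrategy.not_consistency_le (A : AdviceStrategy δ k) (hδ : 0 < δ) {p c ρ e : ℝ}
    (hp : 0 < p) (hpc : p / 2 ≤ c) (hc : p * (c - 1) < c ^ 2)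
    (hρ : 0 < ρ) (he0 : 0 ≤ e) (he1 : e ≤ 1) (hek : 2 ^ k * e < 2) (hce : ρ * (c - 1) ≤ c ^ e)
    (hrob : ∀ h (t : Target δ), (A.strategy h).ServedWithin p t)
    (hcons : ∀ t : Target δ, (A.strategy (A.advice t)).ServedWithin ρ t) : False := by
  choose K C hKC using fun h => (A.strategy h).exists_sum_volume_servedLogs_le hδ hp hpc hc hρ
    he0 he1 hce (hrob h)
  obtain ⟨M, hM⟩ : ∃ M, ∀ h, K h ≤ M := (finite_range K).bddAbove.imp fun M hM h => hM ⟨h, rfl⟩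
  set B := max M (Real.log δ)
  have hcover : ∀ L v, Ioc B L ⊆
      ⋃ h ∈ (Finset.univ : Finset (Fin k → Bool)),
        ((A.strategy h).servedLogs δ ρ v ∩ Ioc (K h) L) := by
    rintro L v s ⟨hs1, hs2⟩
    have hδs : δ ≤ Real.exp s :=
      ((Real.log_lt_iff_lt_exp hδ).1 ((le_max_right _ _).trans_lt hs1)).le
    simp only [Finset.mem_univ, iUnion_true, mem_iUnion]
    refine ⟨A.advice ⟨v, Real.exp s, hδs⟩, ⟨_, rfl, rfl, hcons ⟨v, Real.exp s, hδs⟩⟩, ?_, hs2⟩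
    exact ((hM _).trans (le_max_left _ _)).trans_lt hs1
  have hmain : ∀ L, (2 : ℝ≥0∞) * ENNReal.ofReal (L - B) ≤
      ∑ h, ENNReal.ofReal (e * L + C h) := by
    intro L
    calc (2 : ℝ≥0∞) * ENNReal.ofReal (L - B) = ∑ v : Fin 2, volume (Ioc B L) := by
          simp [Real.volume_Ioc]
      _ ≤ ∑ v : Fin 2, ∑ h, volume ((A.strategy h).servedLogs δ ρ v ∩ Ioc (K h) L) :=
          Finset.sum_le_sum fun v _ =>
            (measure_mono (hcover L v)).trans (measure_biUnion_finset_le _ _)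
      _ = ∑ h, ∑ v : Fin 2, volume ((A.strategy h).servedLogs δ ρ v ∩ Ioc (K h) L) :=
          Finset.sum_comm
      _ ≤ _ := Finset.sum_le_sum fun h _ => hKC h L
  have hreal : ∀ L, B ≤ L → 0 ≤ L → 2 * (L - B) ≤ 2 ^ k * e * L + ∑ h, |C h| := by
    intro L hBL hL
    have h1 : ∑ h, ENNReal.ofReal (e * L + C h) ≤ ENNReal.ofReal (∑ h, (e * L + |C h|)) := by
      rw [ENNReal.ofReal_sum_of_nonneg fun h _ => by positivity]
      exact Finset.sum_le_sum fun h _ =>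
        ENNReal.ofReal_le_ofReal (by linarith [le_abs_self (C h)])
    have h2 := (hmain L).trans h1
    rw [show (2 : ℝ≥0∞) = ENNReal.ofReal 2 by simp, ← ENNReal.ofReal_mul (by norm_num),
      ENNReal.ofReal_le_ofReal_iff (by positivity), Finset.sum_add_distrib] at h2
    simp only [Finset.sum_const, Finset.card_univ, Fintype.card_pi, Fintype.card_bool,
      Finset.prod_const, Fintype.card_fin, nsmul_eq_mul, Nat.cast_pow, Nat.cast_ofNat] at h2
    linarith
  obtain ⟨L, hL⟩ : ∃ L, max (max B 0) ((∑ h, |C h| + 2 * B) / (2 - 2 ^ k * e)) < L :=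
    exists_gt _
  simp only [max_lt_iff] at hL
  rw [div_lt_iff₀ (by linarith)] at hL
  linarith [hreal L hL.1.1.le hL.1.2.le]

/-- Slightly increasing the base and decreasing the exponent keeps a strict inequality. -/
theorem exists_base_exponent {ρ b e : ℝ} (hb : 1 < b) (he : 0 < e)
    (h : ρ * (b - 1) < b ^ e) :
    ∃ c e', b < c ∧ 0 ≤ e' ∧ e' < e ∧ ρ * (c - 1) ≤ c ^ e' := by
  have hb0 : 0 < b := by linarith
  -- The exponent is lowered at the fixed base `b`, then the base is raised at the new exponent;
  -- continuity preserves the strict inequality each time.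
  have h1 : ∀ᶠ x in nhdsWithin e (Iio e), ρ * (b - 1) < b ^ x ∧ 0 < x ∧ x < e := by
    refine Filter.Eventually.and ?_ (Filter.Eventually.and ?_ self_mem_nhdsWithin)
    · exact nhdsWithin_le_nhds
        ((Real.continuousAt_const_rpow hb0.ne').eventually (lt_mem_nhds h))
    · exact nhdsWithin_le_nhds (lt_mem_nhds he)
  obtain ⟨e', he', he'0, he'e⟩ := h1.exists
  have h2 : ∀ᶠ c in nhdsWithin b (Ioi b), ρ * (c - 1) < c ^ e' ∧ b < c := by
    refine Filter.Eventually.and (nhdsWithin_le_nhds ?_) self_mem_nhdsWithin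
    exact ContinuousAt.eventually_lt (by fun_prop)
      (Real.continuousAt_rpow_const _ _ (Or.inl hb0.ne')) he'
  obtain ⟨c, hc, hbc⟩ := h2.exists
  exact ⟨c, e', hbc, he'0.le, he'e, hc.le⟩

end LinearSearch

open LinearSearch in
theorem mainTheorem1 (δ : ℝ) (hδ : 0 < δ) (k : ℕ) (hk : 1 ≤ k) (r : ℝ) (hr : 9 ≤ r)
    (A : LinearSearch.AdviceStrategy δ k) (hA : A.IsRobust r) :
    ENNReal.ofReal
        (1 + 2 * (LinearSearch.geomBase r ^ ((1 : ℝ) / (2 : ℝ) ^ (k - 1))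
          / (LinearSearch.geomBase r - 1)))
      ≤ A.consistency := by
  obtain ⟨b, hb⟩ : ∃ b, b = geomBase r := ⟨_, rfl⟩
  have hb1 : 1 < b := hb ▸ (isGreatest_geomBase hr).1.1
  rw [← hb]
  set e : ℝ := 1 / 2 ^ (k - 1) with he
  have he0 : 0 < e := by positivity
  -- `e = 1 / q` is exactly the critical density, so any smaller exponent contradicts the covering.
  have hke : (2 : ℝ) ^ k * e = 2 := by
    obtain ⟨l, rfl⟩ : ∃ l, k = l + 1 := ⟨k - 1, by omega⟩
    simp only [he, Nat.add_sub_cancel, pow_succ]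
    field_simp
  have he1 : e ≤ 1 := by
    rw [he, div_le_one (by positivity)]
    exact one_le_pow₀ (by norm_num)
  by_contra! hlt
  obtain ⟨ρ, hρ0, hρb, hcons⟩ : ∃ ρ : ℝ, 0 < ρ ∧ ρ < b ^ e / (b - 1) ∧
      A.consistency ≤ ENNReal.ofReal (1 + 2 * ρ) := by
    have hv : 0 < b ^ e / (b - 1) :=
      div_pos (Real.rpow_pos_of_pos (by linarith) _) (by linarith)
    have htop : A.consistency ≠ ∞ := ne_top_of_lt hlt
    have hx : A.consistency.toReal < 1 + 2 * (b ^ e / (b - 1)) := by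
      rwa [← ENNReal.lt_ofReal_iff_toReal_lt htop]
    obtain ⟨ρ, h1, h2⟩ := exists_between (max_lt hv
      (show (A.consistency.toReal - 1) / 2 < b ^ e / (b - 1) by linarith))
    rw [max_lt_iff] at h1
    exact ⟨ρ, h1.1, h2, ENNReal.le_ofReal_iff_toReal_le htop (by linarith) |>.2
      (by linarith [h1.2])⟩
  rw [lt_div_iff₀ (by linarith)] at hρb
  obtain ⟨c, e', hbc, he'0, he'e, hce⟩ := exists_base_exponent hb1 he0 hρb
  refine A.not_consistency_le hδ (p := (r - 1) / 2) (by linarith)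
    (by linarith [le_geomBase hr]) (mul_sub_one_lt_sq_of_geomBase_lt hr (hb ▸ hbc)) hρ0 he'0 (by linarith)
    ?_ hce (A.servedWithin_of_isRobust hδ hA) (A.servedWithin_of_consistency_le hδ hcons)
  exact (mul_lt_mul_of_pos_left he'e (by positivity)).trans_eq hke
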